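/- Let $D$ be a finite distributive lattice whose unit element is join-irreducible (in particular $|D|\ge 2$), let $J(D)$ be the set of its join-irreducible elements, and let $Q \subseteq D$. Then the following two conditions are equivalent. (1) $Q$ is principal congruence representable: there are a finite lattice $L$ and an isomorphism $\varphi$ from the congruence lattice $\operatorname{Con} L$ onto $D$ such that $Q$ is the image under $\varphi$ of the set of principal congruences of $L$ (a congruence is principal if it is the least congruence $\operatorname{con}(a,b)$ collapsing some pair $a, b \in L$). (2) $Q$ is chain representable: there are a finite chain $C$ and a map $\operatorname{col}$ from the set of prime intervals of $C$ (the intervals $[x,y]$ with $x \prec y$) onto $J(D)$ such that $$Q = \Bigl\{\, \bigvee \{\operatorname{col}\mathfrak p : \mathfrak p \text{ a prime interval of } C \text{ contained in } [x,y]\} \;:\; x \le y \text{ in } C \,\Bigr\},$$ where the empty join is the zero of $D$. -/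

import Mathlib

universe u

/-! ### Congruences of a lattice -/

/-- The congruences of a lattice `L`, ordered by inclusion of relations: `θ ≤ ψ` if `θ` relates
no more pairs than `ψ`. For finite `L` this ordered set is the congruence lattice of `L`. -/
instance LatticeCon.instPartialOrder {L : Type u} [Lattice L] : PartialOrder (LatticeCon L) where
  le θ ψ := ∀ x y : L, θ.r x y → ψ.r x y
  le_refl _ _ _ h := h
  le_trans _ _ _ h₁ h₂ x y h := h₂ x y (h₁ x y h)
  le_antisymm θ ψ h₁ h₂ := by
    obtain ⟨s, _, _⟩ := θ
    obtain ⟨t, _, _⟩ := ψ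
    have : s = t := Setoid.ext fun x y => ⟨h₁ x y, h₂ x y⟩
    subst this
    rfl

/-- The principal congruence generated by the pair `a, b`: the intersection of all congruences
of `L` that relate `a` and `b`. -/
def LatticeCon.principal {L : Type u} [Lattice L] (a b : L) : LatticeCon L where
  r x y := ∀ θ : LatticeCon L, θ.r a b → θ.r x y
  iseqv :=
    { refl := fun x θ _ => θ.refl x
      symm := fun h θ hθ => θ.symm (h θ hθ)
      trans := fun h₁ h₂ θ hθ => θ.trans (h₁ θ hθ) (h₂ θ hθ) }
  inf h₁ h₂ := fun θ hθ => θ.inf (h₁ θ hθ) (h₂ θ hθ)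
  sup h₁ h₂ := fun θ hθ => θ.sup (h₁ θ hθ) (h₂ θ hθ)

/-- The principal congruence generated by `a, b` is the least congruence relating `a` and `b`. -/
theorem LatticeCon.isLeast_principal {L : Type u} [Lattice L] (a b : L) :
    IsLeast {θ : LatticeCon L | θ.r a b} (LatticeCon.principal a b) :=
  ⟨fun _ hθ => hθ, fun θ hθ _ _ h => h θ hθ⟩

/-- The set of principal congruences of `L`. -/
def principalCongruences (L : Type u) [Lattice L] : Set (LatticeCon L) :=
  {θ | ∃ a b : L, θ = LatticeCon.principal a b}

/-- `Q ⊆ D` is principal congruence representable: for some finite (nonempty) lattice `L` there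
is an isomorphism of the congruence lattice of `L` with `D` that carries the set of principal
congruences of `L` onto `Q`. -/
def IsPrincipalCongruenceRepresentable {D : Type u} [Lattice D] (Q : Set D) : Prop :=
  ∃ (L : Type u) (_ : Lattice L) (_ : Finite L) (_ : Nonempty L) (φ : LatticeCon L ≃o D),
    φ '' principalCongruences L = Q

/-! ### Colored chains -/

/-- The prime intervals of an ordered set `C`: the pairs `(x, y)` such that `y` covers `x`. -/
abbrev PrimeInterval (C : Type u) [PartialOrder C] : Type u :=
  {p : C × C // p.1 ⋖ p.2}

/-- The ordered set of join-irreducible elements of `D` (the least element is not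
join-irreducible). -/
abbrev JoinIrred (D : Type u) [Lattice D] : Type u :=
  {a : D // SupIrred a}

/-- The color set of the interval `[x, y]`: the colors of the prime intervals contained in
`[x, y]`. -/
def colorSet {C P : Type u} [LinearOrder C] (col : PrimeInterval C → P) (x y : C) : Set P :=
  {c | ∃ p : PrimeInterval C, x ≤ p.1.1 ∧ p.1.2 ≤ y ∧ col p = c}

/-- For a chain `C` colored by the join-irreducible elements of `D`, the set of all the elements
of `D` that are the join of the color set of some interval `[x, y]`, `x ≤ y`, of `C`. The join of
the empty color set is the least element of `D`. -/
def chainRep {C D : Type u} [LinearOrder C] [Lattice D]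
    (col : PrimeInterval C → JoinIrred D) : Set D :=
  {d | ∃ x y : C, x ≤ y ∧ IsLUB (Subtype.val '' colorSet col x y) d}

/-- `Q ⊆ D` is chain representable: there are a finite (nonempty) chain `C` and a coloring of `C`
by the join-irreducible elements of `D`, that is, a map from the prime intervals of `C` onto the
set of join-irreducible elements, such that `Q` consists of the joins of the color sets of the
intervals of `C`. -/
def IsChainRepresentable {D : Type u} [Lattice D] (Q : Set D) : Prop :=
  ∃ (C : Type u) (_ : LinearOrder C) (_ : Finite C) (_ : Nonempty C)
    (col : PrimeInterval C → JoinIrred D),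
    Function.Surjective col ∧ chainRep col = Q

/-! ### Words -/

/-! A colored finite chain amounts to a word of join-irreducible letters, and its intervals to
infixes.

From lattice to word: color each prime interval of a maximal chain from `a ⊓ b` to `a ⊔ b` by its
principal congruence. These colors are join-irreducible (`LatticeCon.supIrred_principal`); all infix
joins are principal, and the whole word gives `con(a, b)`. Linking such words by letters `⊤`
(`exists_infixJoins_union`) adds no join but `⊤`, which is principal because it is join-irreducible.

From word to lattice: closed sets of colored points form a lattice whose congruences are determined
by the points they collapse (`WordLattice.r_iff`), and these are exactly the points of color at most
some `d` (`exists_eq_congruence`). Hence `con(A, B)` corresponds to the join of the colors of the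
points in which `A` and `B` differ. The closure rules make this the join of an infix
(`mem_wordJoins_of_isLUB`), and every infix occurs along the chain of the `x k`. -/

/-- The joins of the infixes of the word `w`. -/
def wordJoins {D : Type u} [Preorder D] {n : ℕ} (w : Fin n → D) : Set D :=
  -- The bounds are unrestricted: `j ≤ i` gives the empty infix, and `j > n` acts as `j = n`.
  {d | ∃ i j : ℕ, IsLUB {e | ∃ k : Fin n, i ≤ k.1 ∧ k.1 < j ∧ w k = e} d}

theorem mem_wordJoins {D : Type u} [PartialOrder D] {n : ℕ} (w : Fin n → D) (i : Fin n) : w i ∈ wordJoins w := by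
  refine ⟨i, i + 1, ?_⟩
  have : {e | ∃ k : Fin n, i.1 ≤ k.1 ∧ k.1 < i + 1 ∧ w k = e} = {w i} := by
    ext e
    constructor
    · rintro ⟨k, h1, h2, rfl⟩
      rw [show k = i from Fin.ext (by omega)]
      rfl
    · rintro rfl
      exact ⟨i, le_rfl, Nat.lt_succ_self _, rfl⟩
  rw [this]
  exact isLUB_singleton

theorem mem_wordJoins_of_isLUB_empty {D : Type u} [Preorder D] {n : ℕ} {w : Fin n → D} {d : D} (hd : IsLUB ∅ d) : d ∈ wordJoins w := by
  refine ⟨0, 0, ?_⟩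
  simpa using hd

theorem Fin.exists_castSucc_succ_of_covBy {n : ℕ} {a b : Fin (n + 1)} (h : a ⋖ b) :
    ∃ k : Fin n, a = k.castSucc ∧ b = k.succ := by
  have h1 : a.1 < b.1 := h.lt
  have h2 : b.1 = a.1 + 1 := by
    by_contra hne
    have h3 : a.1 + 1 < n + 1 := by omega
    exact h.2 (c := ⟨a.1 + 1, h3⟩) (Fin.lt_def.2 (by simp)) (Fin.lt_def.2 (by simp; omega))
  refine ⟨⟨a.1, by omega⟩, Fin.ext (by simp), Fin.ext (by simp [h2])⟩

theorem Fin.castSucc_covBy_succ_self {n : ℕ} (k : Fin n) : k.castSucc ⋖ k.succ := by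
  refine ⟨Fin.castSucc_lt_succ, fun c h1 h2 => ?_⟩
  simp only [Fin.lt_def, Fin.val_castSucc, Fin.val_succ] at h1 h2
  omega

/-- The joins of the color sets of a colored chain are the joins of the infixes of the word of its
colors. -/
theorem chainRep_eq_wordJoins {C D : Type u} [LinearOrder C] [Lattice D]
    (col : PrimeInterval C → JoinIrred D) {n : ℕ} (e : Fin (n + 1) ≃o C) :
    chainRep col = wordJoins fun k : Fin n =>
      (col ⟨(e k.castSucc, e k.succ),
        (apply_covBy_apply_iff e).2 (Fin.castSucc_covBy_succ_self k)⟩).1 := by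
  have key : ∀ i j : Fin (n + 1), Subtype.val '' colorSet col (e i) (e j) =
      {d | ∃ k : Fin n, i.1 ≤ k.1 ∧ k.1 < j.1 ∧ (col ⟨(e k.castSucc, e k.succ),
        (apply_covBy_apply_iff e).2 (Fin.castSucc_covBy_succ_self k)⟩).1 = d} := by
    intro i j
    ext d
    constructor
    · rintro ⟨_, ⟨⟨⟨x, y⟩, hp⟩, h1, h2, rfl⟩, rfl⟩
      obtain ⟨s, rfl⟩ := e.surjective x
      obtain ⟨t, rfl⟩ := e.surjective y
      obtain ⟨k, rfl, rfl⟩ := Fin.exists_castSucc_succ_of_covBy ((apply_covBy_apply_iff e).1 hp)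
      have h1 := e.le_iff_le.1 h1
      have h2 := e.le_iff_le.1 h2
      simp only [Fin.le_def, Fin.val_castSucc, Fin.val_succ] at h1 h2
      exact ⟨k, h1, h2, rfl⟩
    · rintro ⟨k, h1, h2, rfl⟩
      refine ⟨_, ⟨⟨(e k.castSucc, e k.succ), _⟩, e.le_iff_le.2 ?_, e.le_iff_le.2 ?_, rfl⟩, rfl⟩
      · simpa [Fin.le_def] using h1
      · simpa [Fin.le_def] using h2
  ext d
  constructor
  · rintro ⟨x, y, -, h⟩
    obtain ⟨i, rfl⟩ := e.surjective x
    obtain ⟨j, rfl⟩ := e.surjective y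
    rw [key] at h
    exact ⟨i, j, h⟩
  · rintro ⟨i, j, h⟩
    -- Clipping the bounds makes them ordered points of the chain without changing the infix.
    refine ⟨e ⟨min i (min j n), by omega⟩, e ⟨min j n, by omega⟩,
      e.le_iff_le.2 (Fin.le_def.2 (by simp)), ?_⟩
    rw [key]
    have hk : ∀ k : Fin n, (min i (min j n) ≤ k.1 ∧ k.1 < min j n) ↔ (i ≤ k.1 ∧ k.1 < j) := by
      omega
    simpa only [← and_assoc, hk] using h

theorem isChainRepresentable_iff {D : Type u} [Lattice D] (Q : Set D) :
    IsChainRepresentable Q ↔ ∃ (n : ℕ) (w : Fin n → D), (∀ k, SupIrred (w k)) ∧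
      (∀ a, SupIrred a → ∃ k, w k = a) ∧ wordJoins w = Q := by
  constructor
  · rintro ⟨C, _, _, _, col, hcol, rfl⟩
    have := Fintype.ofFinite C
    obtain ⟨n, hn⟩ : ∃ n, Fintype.card C = n + 1 :=
      Nat.exists_eq_succ_of_ne_zero Fintype.card_ne_zero
    let e : Fin (n + 1) ≃o C := Fintype.orderIsoFinOfCardEq C hn
    refine ⟨n, _, fun k => ?_, fun a ha => ?_, (chainRep_eq_wordJoins col e).symm⟩
    · exact Subtype.property _
    · obtain ⟨⟨⟨x, y⟩, hp⟩, h⟩ := hcol ⟨a, ha⟩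
      obtain ⟨s, rfl⟩ := e.surjective x
      obtain ⟨t, rfl⟩ := e.surjective y
      obtain ⟨k, rfl, rfl⟩ := Fin.exists_castSucc_succ_of_covBy ((apply_covBy_apply_iff e).1 hp)
      exact ⟨k, congrArg Subtype.val h⟩
  · rintro ⟨n, w, hw, hs, rfl⟩
    let e : Fin (n + 1) ≃o ULift.{u} (Fin (n + 1)) :=
      { toEquiv := Equiv.ulift.symm, map_rel_iff' := Iff.rfl }
    have hex : ∀ p : PrimeInterval (ULift.{u} (Fin (n + 1))),
        ∃ k : Fin n, p.1.1 = e k.castSucc ∧ p.1.2 = e k.succ := by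
      rintro ⟨⟨x, y⟩, hp⟩
      obtain ⟨s, rfl⟩ := e.surjective x
      obtain ⟨t, rfl⟩ := e.surjective y
      obtain ⟨k, rfl, rfl⟩ := Fin.exists_castSucc_succ_of_covBy ((apply_covBy_apply_iff e).1 hp)
      exact ⟨k, rfl, rfl⟩
    choose f hf using hex
    have hfk : ∀ (k : Fin n) hp, f ⟨(e k.castSucc, e k.succ), hp⟩ = k := fun k hp =>
      (Fin.castSucc_injective n (e.injective (hf ⟨(e k.castSucc, e k.succ), hp⟩).1)).symm
    refine ⟨ULift.{u} (Fin (n + 1)), inferInstance, inferInstance, inferInstance,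
      fun p => ⟨w (f p), hw _⟩, ?_, ?_⟩
    · rintro ⟨a, ha⟩
      obtain ⟨k, rfl⟩ := hs a ha
      exact ⟨⟨(e k.castSucc, e k.succ),
        (apply_covBy_apply_iff e).2 (Fin.castSucc_covBy_succ_self k)⟩, Subtype.ext (by simp [hfk])⟩
    · rw [chainRep_eq_wordJoins _ e]
      simp only [hfk]

/-! ### Principal congruences of a finite lattice -/

namespace LatticeCon

variable {L : Type u} [Lattice L]

theorem principal_le_iff {a b : L} {θ : LatticeCon L} : principal a b ≤ θ ↔ θ.r a b :=
  ⟨fun h => h _ _ (isLeast_principal a b).1, fun h => (isLeast_principal a b).2 h⟩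

theorem principal_inf_sup (a b : L) : principal (a ⊓ b) (a ⊔ b) = principal a b :=
  le_antisymm (principal_le_iff.2 ((r_inf_sup_iff _).2 (isLeast_principal a b).1))
    (principal_le_iff.2 ((r_inf_sup_iff _).1 (isLeast_principal _ _).1))

/-- A congruence relates all the elements of an interval whose ends it relates. -/
theorem r_of_mem_Icc (θ : LatticeCon L) {a b c d : L} (h : θ.r a d) (hab : a ≤ b) (hbc : b ≤ c)
    (hcd : c ≤ d) : θ.r b c := by
  have h1 := θ.sup (θ.inf h (θ.refl c)) (θ.refl b)
  rwa [inf_eq_left.2 (hab.trans hbc), inf_eq_right.2 hcd, sup_eq_right.2 hab,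
    sup_eq_left.2 hbc] at h1

/-- The least congruence above two congruences. -/
def join (θ ψ : LatticeCon L) : LatticeCon L :=
  have hinf : ∀ {x y : L} (z : L), Relation.EqvGen (fun x y => θ.r x y ∨ ψ.r x y) x y →
      Relation.EqvGen (fun x y => θ.r x y ∨ ψ.r x y) (x ⊓ z) (y ⊓ z) := fun z h => by
    induction h with
    | rel x y h => exact .rel _ _ (h.imp (θ.inf · (θ.refl z)) (ψ.inf · (ψ.refl z)))
    | refl x => exact .refl _
    | symm x y _ ih => exact .symm _ _ ih
    | trans x y t _ _ ih₁ ih₂ => exact .trans _ _ _ ih₁ ih₂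
  have hsup : ∀ {x y : L} (z : L), Relation.EqvGen (fun x y => θ.r x y ∨ ψ.r x y) x y →
      Relation.EqvGen (fun x y => θ.r x y ∨ ψ.r x y) (x ⊔ z) (y ⊔ z) := fun z h => by
    induction h with
    | rel x y h => exact .rel _ _ (h.imp (θ.sup · (θ.refl z)) (ψ.sup · (ψ.refl z)))
    | refl x => exact .refl _
    | symm x y _ ih => exact .symm _ _ ih
    | trans x y t _ _ ih₁ ih₂ => exact .trans _ _ _ ih₁ ih₂
  { r := Relation.EqvGen fun x y => θ.r x y ∨ ψ.r x y
    iseqv := Relation.EqvGen.is_equivalence _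
    inf := fun {w x y z} h₁ h₂ => .trans _ _ _ (hinf y h₁) (by
      rw [inf_comm x, inf_comm x]; exact hinf x h₂)
    sup := fun {w x y z} h₁ h₂ => .trans _ _ _ (hsup y h₁) (by
      rw [sup_comm x, sup_comm x]; exact hsup x h₂) }

theorem le_join_left (θ ψ : LatticeCon L) : θ ≤ join θ ψ := fun _ _ h => .rel _ _ (.inl h)

theorem le_join_right (θ ψ : LatticeCon L) : ψ ≤ join θ ψ := fun _ _ h => .rel _ _ (.inr h)

/-- A join of two congruences relating a covering pair has a joinand that relates it. -/
theorem r_or_r_of_join {θ ψ : LatticeCon L} {a b : L} (hab : a ⋖ b) (h : (join θ ψ).r a b) :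
    θ.r a b ∨ ψ.r a b := by
  by_contra! hn
  -- The polynomial `(x ⊔ a) ⊓ b` takes only the values `a` and `b`. A congruence not relating these
  -- makes it constant on classes, and so do two such congruences on the classes of their join; but
  -- it fixes `a` and `b`.
  have clamp : ∀ x : L, (x ⊔ a) ⊓ b = a ∨ (x ⊔ a) ⊓ b = b := fun x =>
    hab.eq_or_eq (le_inf le_sup_right hab.le) inf_le_right
  have key : ∀ χ : LatticeCon L, ¬ χ.r a b → ∀ x y, χ.r x y → (x ⊔ a) ⊓ b = (y ⊔ a) ⊓ b := by
    intro χ hχ x y hxy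
    have h1 : χ.r ((x ⊔ a) ⊓ b) ((y ⊔ a) ⊓ b) := χ.inf (χ.sup hxy (χ.refl a)) (χ.refl b)
    rcases clamp x with hx | hx <;> rcases clamp y with hy | hy <;> rw [hx, hy] at h1 ⊢
    · exact (hχ h1).elim
    · exact (hχ (χ.symm h1)).elim
  have main : ∀ x y, (join θ ψ).r x y → (x ⊔ a) ⊓ b = (y ⊔ a) ⊓ b := by
    intro x y hxy
    induction hxy with
    | rel x y h => exact h.elim (key θ hn.1 x y) (key ψ hn.2 x y)
    | refl x => rfl
    | symm x y _ ih => exact ih.symm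
    | trans x y t _ _ ih₁ ih₂ => exact ih₁.trans ih₂
  have := main a b h
  rw [sup_idem, inf_eq_left.2 hab.le, sup_eq_left.2 hab.le, inf_idem] at this
  exact hab.ne this

/-- The congruence relating only equal elements. -/
def diagonal (L : Type u) [Lattice L] : LatticeCon L where
  r := Eq
  iseqv := eq_equivalence
  inf := by rintro _ _ _ _ rfl rfl; rfl
  sup := by rintro _ _ _ _ rfl rfl; rfl

/-- The principal congruence of a prime interval is join-irreducible. -/
theorem supIrred_principal {D : Type*} [Lattice D] (φ : LatticeCon L ≃o D) {a b : L}
    (hab : a ⋖ b) : SupIrred (φ (principal a b)) := by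
  constructor
  · intro hmin
    have h1 : principal a b ≤ diagonal L := by
      rw [← φ.le_iff_le]
      exact (hmin inf_le_left).trans inf_le_right
    exact hab.ne (principal_le_iff.1 h1)
  · intro x y hxy
    obtain ⟨θ, rfl⟩ := φ.surjective x
    obtain ⟨ψ, rfl⟩ := φ.surjective y
    have h1 : (join θ ψ).r a b := by
      rw [← principal_le_iff, ← φ.le_iff_le, ← hxy]
      exact sup_le (φ.monotone (le_join_left _ _)) (φ.monotone (le_join_right _ _))
    refine (r_or_r_of_join hab h1).imp (fun h => ?_) fun h => ?_
    · exact le_antisymm (hxy ▸ le_sup_left) (φ.monotone (principal_le_iff.2 h))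
    · exact le_antisymm (hxy ▸ le_sup_right) (φ.monotone (principal_le_iff.2 h))

theorem apply_principal_self {D : Type*} [Lattice D] [OrderBot D] (φ : LatticeCon L ≃o D) (a : L) :
    φ (principal a a) = ⊥ := by
  have h : ∀ θ, principal a a ≤ θ := fun θ => principal_le_iff.2 (θ.refl a)
  refine bot_unique ?_
  rw [← φ.le_symm_apply]
  exact h _

/-- One inequality is convexity of congruence classes, the other transitivity through `b`. -/
theorem apply_principal_sup {D : Type*} [Lattice D] (φ : LatticeCon L ≃o D) {a b c : L}
    (hab : a ≤ b) (hbc : b ≤ c) :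
    φ (principal a b) ⊔ φ (principal b c) = φ (principal a c) := by
  have hac : (principal a c).r a c := (isLeast_principal a c).1
  refine le_antisymm (sup_le ?_ ?_) ?_
  · exact φ.monotone (principal_le_iff.2 (r_of_mem_Icc _ hac le_rfl hab hbc))
  · exact φ.monotone (principal_le_iff.2 (r_of_mem_Icc _ hac hab hbc le_rfl))
  · rw [← φ.le_symm_apply, principal_le_iff]
    have h1 : (φ.symm (φ (principal a b) ⊔ φ (principal b c))).r a b := by
      rw [← principal_le_iff, φ.le_symm_apply]; exact le_sup_left
    have h2 : (φ.symm (φ (principal a b) ⊔ φ (principal b c))).r b c := by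
      rw [← principal_le_iff, φ.le_symm_apply]; exact le_sup_right
    exact (φ.symm (φ (principal a b) ⊔ φ (principal b c))).trans h1 h2

end LatticeCon


theorem exists_covBy_path {L : Type u} [PartialOrder L] [Finite L] {a b : L} (hab : a ≤ b) :
    ∃ (m : ℕ) (x : ℕ → L), x 0 = a ∧ x m = b ∧ ∀ k < m, x k ⋖ x (k + 1) := by
  classical
  have := Fintype.ofFinite L
  let _ : LocallyFiniteOrder L := Fintype.toLocallyFiniteOrder
  have h := le_iff_reflTransGen_covBy.1 hab
  induction h with
  | refl => exact ⟨0, fun _ => a, rfl, rfl, by simp⟩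
  | @tail b c h hbc ih =>
    obtain ⟨m, x, h0, hm, hx⟩ := ih (le_iff_reflTransGen_covBy.2 h)
    refine ⟨m + 1, fun k => if k ≤ m then x k else c, by simp [h0], by simp, fun k hk => ?_⟩
    rcases Nat.lt_succ_iff_lt_or_eq.1 hk with h | rfl
    · have h' : k + 1 ≤ m := h
      simpa [h.le, h'] using hx k h
    · simpa [hm] using hbc

/-! ### Infix joins and concatenation of words -/

section Words

variable {D : Type u} [Lattice D] [OrderBot D]

/-- The joins of the infixes of the first `n` letters of `w`. -/
def infixJoins (n : ℕ) (w : ℕ → D) : Set D :=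
  {d | ∃ i j, j ≤ n ∧ (Finset.Ico i j).sup w = d}

theorem wordJoins_eq_infixJoins (n : ℕ) (w : ℕ → D) :
    wordJoins (fun k : Fin n => w k) = infixJoins n w := by
  have key : ∀ i j, j ≤ n → IsLUB {e | ∃ k : Fin n, i ≤ k.1 ∧ k.1 < j ∧ w k = e}
      ((Finset.Ico i j).sup w) := by
    intro i j hj
    constructor
    · rintro _ ⟨k, h1, h2, rfl⟩
      exact Finset.le_sup (f := w) (Finset.mem_Ico.2 ⟨h1, h2⟩)
    · intro d hd
      refine Finset.sup_le fun k hk => hd ?_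
      rw [Finset.mem_Ico] at hk
      exact ⟨⟨k, hk.2.trans_le hj⟩, hk.1, hk.2, rfl⟩
  ext d
  constructor
  · rintro ⟨i, j, h⟩
    have h2 := key i (min j n) (min_le_right _ _)
    have hk : ∀ k : Fin n, k.1 < min j n ↔ k.1 < j := by omega
    simp only [hk] at h2
    exact ⟨i, min j n, min_le_right _ _, h2.unique h⟩
  · rintro ⟨i, j, hj, rfl⟩
    exact ⟨i, j, key i j hj⟩

/-- Two words can be joined by a letter `⊤`. -/
theorem exists_infixJoins_union [OrderTop D] {Q : Set D} (hD : SupIrred (⊤ : D)) (hQ : ⊤ ∈ Q)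
    {n m : ℕ} {w v : ℕ → D} (hw : ∀ k < n, SupIrred (w k)) (hv : ∀ k < m, SupIrred (v k))
    (hwQ : infixJoins n w ⊆ Q) (hvQ : infixJoins m v ⊆ Q) :
    ∃ (N : ℕ) (W : ℕ → D), (∀ k < N, SupIrred (W k)) ∧ infixJoins N W ⊆ Q ∧
      infixJoins n w ⊆ infixJoins N W ∧ infixJoins m v ⊆ infixJoins N W := by
  let W : ℕ → D := fun k => if k < n then w k else if k = n then ⊤ else v (k - (n + 1))
  have h1 : ∀ i j, j ≤ n → (Finset.Ico i j).sup W = (Finset.Ico i j).sup w := by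
    refine fun i j hj => Finset.sup_congr rfl fun k hk => ?_
    rw [Finset.mem_Ico] at hk
    have : k < n := by omega
    simp [W, this]
  have h2 : ∀ i j, (Finset.Ico (i + (n + 1)) (j + (n + 1))).sup W = (Finset.Ico i j).sup v := by
    intro i j
    rw [← Finset.map_add_right_Ico, Finset.sup_map]
    refine Finset.sup_congr rfl fun k hk => ?_
    have h3 : ¬ k + (n + 1) < n := by omega
    have h4 : ¬ k + (n + 1) = n := by omega
    simp [W, h3, h4]
  refine ⟨m + (n + 1), W, fun k hk => ?_, ?_, ?_, ?_⟩
  · simp only [W]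
    split_ifs with h h'
    · exact hw k h
    · exact hD
    · exact hv _ (by omega)
  · rintro _ ⟨i, j, hj, rfl⟩
    by_cases hjn : j ≤ n
    · exact hwQ ⟨i, j, hjn, (h1 i j hjn).symm⟩
    by_cases hin : i ≤ n
    -- This infix contains the linking letter, so its join is `⊤`.
    · convert hQ
      refine top_unique ?_
      have : W n = ⊤ := by simp [W]
      rw [← this]
      exact Finset.le_sup (Finset.mem_Ico.2 ⟨hin, by omega⟩)
    · refine hvQ ⟨i - (n + 1), j - (n + 1), by omega, ?_⟩
      rw [← h2]
      congr 2 <;> omega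
  · rintro _ ⟨i, j, hj, rfl⟩
    exact ⟨i, j, by omega, h1 i j hj⟩
  · rintro _ ⟨i, j, hj, rfl⟩
    exact ⟨i + (n + 1), j + (n + 1), by omega, h2 i j⟩

end Words

/-! ### From a lattice to a chain -/

theorem IsPrincipalCongruenceRepresentable.isChainRepresentable {D : Type u} [Lattice D]
    [BoundedOrder D] [Finite D] (hD : SupIrred (⊤ : D)) {Q : Set D}
    (h : IsPrincipalCongruenceRepresentable Q) : IsChainRepresentable Q := by
  classical
  have := Fintype.ofFinite D
  obtain ⟨L, _, _, _, φ, rfl⟩ := h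
  set Q := φ '' principalCongruences L with hQdef
  have hmem : ∀ a b, φ (LatticeCon.principal a b) ∈ Q := fun a b => ⟨_, ⟨a, b, rfl⟩, rfl⟩
  -- Every congruence is the join of the principal ones below it, so a join-irreducible one is
  -- itself principal.
  have hirr : ∀ a : D, SupIrred a → a ∈ Q := by
    intro a ha
    have hs : (Finset.univ.filter fun q => q ∈ Q ∧ q ≤ a).sup id = a := by
      refine le_antisymm (Finset.sup_le fun q hq => (Finset.mem_filter.1 hq).2.2) ?_
      rw [← φ.symm.le_iff_le]
      intro x y hxy
      rw [← LatticeCon.principal_le_iff, φ.le_symm_apply] at hxy ⊢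
      exact Finset.le_sup (f := id) (by simp [hmem, hxy])
    obtain ⟨q, hq, rfl⟩ := ha.finset_sup_eq hs
    exact (Finset.mem_filter.1 hq).2.1
  have hword : ∀ q ∈ Q, ∃ (n : ℕ) (w : ℕ → D), (∀ k < n, SupIrred (w k)) ∧
      infixJoins n w ⊆ Q ∧ q ∈ infixJoins n w := by
    rintro _ ⟨_, ⟨a, b, rfl⟩, rfl⟩
    obtain ⟨m, x, h0, hm, hx⟩ := exists_covBy_path (inf_le_sup : a ⊓ b ≤ a ⊔ b)
    have key : ∀ i j, i ≤ j → j ≤ m → x i ≤ x j ∧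
        (Finset.Ico i j).sup (fun k => φ (LatticeCon.principal (x k) (x (k + 1)))) =
          φ (LatticeCon.principal (x i) (x j)) := by
      intro i j hij
      induction j, hij using Nat.le_induction with
      | base => exact fun _ => ⟨le_rfl, by simp [LatticeCon.apply_principal_self]⟩
      | succ j hij ih =>
        intro hj
        obtain ⟨h1, h2⟩ := ih (by omega)
        have h3 := (hx j (by omega)).le
        refine ⟨h1.trans h3, ?_⟩
        rw [← Finset.insert_Ico_right_eq_Ico_add_one hij, Finset.sup_insert, h2, sup_comm,
          LatticeCon.apply_principal_sup φ h1 h3]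
    refine ⟨m, _, fun k hk => LatticeCon.supIrred_principal φ (hx k hk), ?_,
      0, m, le_rfl, ?_⟩
    · rintro _ ⟨i, j, hj, rfl⟩
      rcases le_total i j with hij | hij
      · rw [(key i j hij hj).2]
        exact hmem _ _
      · rw [Finset.Ico_eq_empty_of_le hij, Finset.sup_empty,
          ← LatticeCon.apply_principal_self φ a]
        exact hmem _ _
    · rw [(key 0 m (Nat.zero_le _) le_rfl).2, h0, hm, LatticeCon.principal_inf_sup]
  have hall : ∀ T : Finset D, ↑T ⊆ Q → ∃ (n : ℕ) (w : ℕ → D), (∀ k < n, SupIrred (w k)) ∧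
      infixJoins n w ⊆ Q ∧ ↑T ⊆ infixJoins n w := by
    intro T
    induction T using Finset.induction_on with
    | empty =>
      intro _
      obtain ⟨n, w, h1, h2, -⟩ := hword ⊤ (hirr _ hD)
      exact ⟨n, w, h1, h2, by simp⟩
    | insert q T _ ih =>
      intro hT
      rw [Finset.coe_insert, Set.insert_subset_iff] at hT
      obtain ⟨n, w, h1, h2, h3⟩ := ih hT.2
      obtain ⟨m, v, h4, h5, h6⟩ := hword q hT.1
      obtain ⟨N, W, h7, h8, h9, h10⟩ := exists_infixJoins_union hD (hirr _ hD) h1 h4 h2 h5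
      refine ⟨N, W, h7, h8, ?_⟩
      rw [Finset.coe_insert, Set.insert_subset_iff]
      exact ⟨h10 h6, h3.trans h9⟩
  obtain ⟨n, w, h1, h2, h3⟩ := hall Q.toFinset (by simp)
  rw [Set.coe_toFinset] at h3
  refine (isChainRepresentable_iff Q).2 ⟨n, fun k => w k, fun k => h1 k k.2, fun a ha => ?_,
    (wordJoins_eq_infixJoins n w).trans (h2.antisymm h3)⟩
  -- A join-irreducible infix join is one of the letters of the infix, so all colors occur.
  obtain ⟨i, j, hj, hij⟩ := h3 (hirr a ha)
  obtain ⟨k, hk, hka⟩ := ha.finset_sup_eq hij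
  exact ⟨⟨k, (Finset.mem_Ico.1 hk).2.trans_le hj⟩, hka⟩

/-! ### The lattice of a word -/

/-- The points of the lattice of a word of length `n`: two auxiliary atoms `z c`, a chain
`x0 < x 0 < x 1 < ⋯`, and for each letter a chain `a i < b i`. -/
inductive WordPoint (n : ℕ) : Type u
  | z (c : Bool)
  | x0
  | x (i : Fin n)
  | a (i : Fin n)
  | b (i : Fin n)

namespace WordPoint

variable {n : ℕ}

instance : Finite (WordPoint.{u} n) := by
  let f : WordPoint.{u} n → Bool ⊕ Unit ⊕ Fin n ⊕ Fin n ⊕ Fin n := fun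
    | z c => .inl c
    | x0 => .inr (.inl ())
    | x i => .inr (.inr (.inl i))
    | a i => .inr (.inr (.inr (.inl i)))
    | b i => .inr (.inr (.inr (.inr i)))
  refine Finite.of_injective f ?_
  rintro (_ | _ | _ | _ | _) (_ | _ | _ | _ | _) h <;> simp_all [f]

/-- The color of a point: the atoms have color `⊤`, the two points that belong to a letter have
this letter as their color. -/
def color {D : Type u} [Top D] (w : Fin n → D) : WordPoint.{u} n → D
  | z _ => ⊤
  | x0 => ⊤
  | x i => w i
  | a _ => ⊤
  | b i => w i

/-- The points that are at most `p`. -/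
def down : WordPoint.{u} n → Set (WordPoint.{u} n)
  | z c => {z c}
  | x0 => {x0}
  | x i => {p | p = x0 ∨ ∃ j ≤ i, p = x j}
  | a i => {a i}
  | b i => {a i, b i}

/-- The height of a point. -/
def rank : WordPoint.{u} n → ℕ
  | z _ => 0
  | x0 => 0
  | x i => i + 1
  | a _ => 0
  | b _ => 1

theorem mem_down (p : WordPoint.{u} n) : p ∈ down p := by
  cases p <;> simp [down]

theorem rank_lt {p q : WordPoint.{u} n} (hq : q ∈ down p) (hne : q ≠ p) : rank q < rank p := by
  cases p with
  | x i =>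
    rcases hq with rfl | ⟨j, hj, rfl⟩
    · simp [rank]
    · have : j ≠ i := fun h => hne (by rw [h])
      simpa [rank] using lt_of_le_of_ne hj this
  | b i => rcases hq with rfl | rfl <;> simp_all [rank]
  | _ => exact (hne hq).elim

/-- The sets of points that are closed under the implications defining the lattice of `w`. -/
structure Closed {D : Type u} [LE D] [Top D] (w : Fin n → D) (A : Set (WordPoint.{u} n)) :
    Prop where
  x_mem {i j} : x i ∈ A → j ≤ i → x j ∈ A
  x0_mem {i} : x i ∈ A → x0 ∈ A
  a_mem {i} : b i ∈ A → a i ∈ A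
  -- `x0` and `b i` force `x i`, hence every `x j` with `j < i`. Unless `x0` and `a i` already
  -- forced these, collapsing `b i` would collapse them whatever their color.
  x_mem_of_a {i j} : x0 ∈ A → a i ∈ A → j < i → x j ∈ A
  -- This rule and the next make `x i` and `b i` collapse together.
  b_mem_of_x {i} : x i ∈ A → a i ∈ A → b i ∈ A
  x_mem_of_b {i} : x0 ∈ A → b i ∈ A → x i ∈ A
  -- Collapsing a letter collapses all smaller letters.
  b_mem_of_b {i j} : b i ∈ A → a j ∈ A → w j ≤ w i → b j ∈ A
  -- Collapsing a letter `⊤` collapses the atoms `z c`.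
  mem_of_top {i} (p) : x0 ∈ A → b i ∈ A → w i = ⊤ → p ∈ A
  -- Away from `x0`, this keeps the colors between two closed sets comparable unless `⊤` is among
  -- them.
  mem_of_not_le {i j} (p) : a i ∈ A → a j ∈ A → ¬ w i ≤ w j → ¬ w j ≤ w i → p ∈ A
  -- Collapsing any atom collapses everything.
  mem_of_z {c q} (p) : z c ∈ A → q ∈ A → q ≠ z c → p ∈ A

variable {D : Type u}

variable [PartialOrder D] [OrderTop D] {w : Fin n → D}

theorem Closed.down_subset {A : Set (WordPoint.{u} n)} (hA : Closed w A) {p : WordPoint.{u} n}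
    (hp : p ∈ A) : down p ⊆ A := by
  intro q hq
  cases p with
  | x i =>
    rcases hq with rfl | ⟨j, hj, rfl⟩
    · exact hA.x0_mem hp
    · exact hA.x_mem hp hj
  | b i =>
    rcases hq with rfl | rfl
    · exact hA.a_mem hp
    · exact hp
  | _ => rwa [Set.mem_singleton_iff.1 hq]

theorem closed_univ : Closed w (Set.univ : Set (WordPoint.{u} n)) := by
  constructor <;> simp

theorem Closed.sInter {S : Set (Set (WordPoint.{u} n))} (hS : ∀ A ∈ S, Closed w A) :
    Closed w (⋂₀ S) where
  x_mem h h' A hA := (hS A hA).x_mem (h A hA) h'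
  x0_mem h A hA := (hS A hA).x0_mem (h A hA)
  a_mem h A hA := (hS A hA).a_mem (h A hA)
  x_mem_of_a h h' h'' A hA := (hS A hA).x_mem_of_a (h A hA) (h' A hA) h''
  b_mem_of_x h h' A hA := (hS A hA).b_mem_of_x (h A hA) (h' A hA)
  x_mem_of_b h h' A hA := (hS A hA).x_mem_of_b (h A hA) (h' A hA)
  b_mem_of_b h h' h'' A hA := (hS A hA).b_mem_of_b (h A hA) (h' A hA) h''
  mem_of_top p h h' h'' A hA := (hS A hA).mem_of_top p (h A hA) (h' A hA) h''
  mem_of_not_le p h h' h₁ h₂ A hA := (hS A hA).mem_of_not_le p (h A hA) (h' A hA) h₁ h₂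
  mem_of_z p h h₁ h₂ A hA := (hS A hA).mem_of_z p (h A hA) (h₁ A hA) h₂

theorem Closed.inter {A B : Set (WordPoint.{u} n)} (hA : Closed w A) (hB : Closed w B) :
    Closed w (A ∩ B) := by
  rw [← Set.sInter_pair]
  exact Closed.sInter (by rintro _ (rfl | rfl) <;> assumption)

theorem closed_down (p : WordPoint.{u} n) : Closed w (down p) := by
  cases p <;> constructor <;> simp only [down] <;> grind

theorem closed_lower (p : WordPoint.{u} n) : Closed w (down p \ {p}) := by
  cases p <;> constructor <;> simp only [down] <;> grind

theorem closed_chain (m : ℕ) :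
    Closed w ({p | p = x0 ∨ ∃ k : Fin n, k.1 < m ∧ p = x k} : Set (WordPoint.{u} n)) := by
  constructor <;> grind

/-- This is the join of `x0` and `a i`. It omits `x i`, `b i` and both `z c`, so it can serve as `K`
in `Collapses.of_closed`. -/
theorem closed_x0_a (i : Fin n) :
    Closed w ({p | p = x0 ∨ p = a i ∨ ∃ j < i, p = x j} : Set (WordPoint.{u} n)) := by
  constructor <;> grind

theorem closed_pair {i j : Fin n} (h : w j ≤ w i) :
    Closed w ({a i, a j} : Set (WordPoint.{u} n)) := by
  constructor <;> grind

/-- The largest closed set that agrees with the closed set `M` up to points with color at most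
`d`, where `d ≠ ⊤`. -/
def saturation (w : Fin n → D) (d : D) (M : Set (WordPoint.{u} n)) : Set (WordPoint.{u} n) :=
  {p | match p with
    | z c => z c ∈ M
    | x0 => x0 ∈ M
    | x i => x0 ∈ M ∧ ∀ j ≤ i, w j ≤ d ∨ x j ∈ M
    | a i => a i ∈ M
    | b i => a i ∈ M ∧ (w i ≤ d ∨ b i ∈ M)}

/-- The rules that force every point already fire in `M`, since `d ≠ ⊤` and added points have color
at most `d`. For `x_mem_of_b`, the smaller `x j` lie in `M` by `x_mem_of_a`. -/
theorem Closed.saturation {M : Set (WordPoint.{u} n)} (hM : Closed w M) {d : D} (hd : d ≠ ⊤) :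
    Closed w (saturation w d M) where
  x_mem h h' := ⟨h.1, fun k hk => h.2 k (hk.trans h')⟩
  x0_mem h := h.1
  a_mem h := h.1
  x_mem_of_a {i j} h h' hj := ⟨h, fun k hk => .inr (hM.x_mem_of_a h h' (hk.trans_lt hj))⟩
  b_mem_of_x {i} h h' := ⟨h', (h.2 i le_rfl).imp_right fun hx => hM.b_mem_of_x hx h'⟩
  x_mem_of_b {i} h h' := ⟨h, fun j hj => hj.lt_or_eq.elim
    (fun hlt => .inr (hM.x_mem_of_a h h'.1 hlt))
    fun he => he ▸ h'.2.imp_right fun hb => hM.x_mem_of_b h hb⟩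
  b_mem_of_b h h' hle := ⟨h', h.2.imp hle.trans fun hb => hM.b_mem_of_b hb h' hle⟩
  mem_of_top p h h' hi := by
    have h1 : ∀ q, q ∈ M := fun q => hM.mem_of_top q h
      (h'.2.resolve_left fun h2 => hd (top_unique (hi ▸ h2))) hi
    cases p <;> simp [WordPoint.saturation, h1]
  mem_of_not_le p h h' h₁ h₂ := by
    have h1 : ∀ q, q ∈ M := fun q => hM.mem_of_not_le q h h' h₁ h₂
    cases p <;> simp [WordPoint.saturation, h1]
  mem_of_z {c q} p h hq hne := by
    have h0 : ∃ r ∈ M, r ≠ z c := by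
      cases q with
      | z c' => exact ⟨_, hq, hne⟩
      | x0 => exact ⟨_, hq, hne⟩
      | x i => exact ⟨x0, hq.1, by simp⟩
      | a i => exact ⟨_, hq, hne⟩
      | b i => exact ⟨a i, hq.1, by simp⟩
    obtain ⟨r, hr, hrne⟩ := h0
    have h1 : ∀ q, q ∈ M := fun q => hM.mem_of_z q h hr hrne
    cases p <;> simp [WordPoint.saturation, h1]

theorem Closed.subset_saturation {A M : Set (WordPoint.{u} n)} (hA : Closed w A) {d : D}
    (hd : d ≠ ⊤) (h : ∀ p ∈ A, ¬ color w p ≤ d → p ∈ M) : A ⊆ WordPoint.saturation w d M := by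
  have htop : ¬ ⊤ ≤ d := fun h => hd (top_unique h)
  intro p hp
  cases p with
  | z c => exact h _ hp htop
  | x0 => exact h _ hp htop
  | x i => exact ⟨h _ (hA.x0_mem hp) htop, fun j hj => or_iff_not_imp_left.2 fun hj' =>
      h (x j) (hA.x_mem hp hj) hj'⟩
  | a i => exact h _ hp htop
  | b i => exact ⟨h _ (hA.a_mem hp) htop, or_iff_not_imp_left.2 fun hj' => h (b i) hp hj'⟩

theorem mem_of_mem_saturation {M : Set (WordPoint.{u} n)} {d : D} {p : WordPoint.{u} n}
    (hp : p ∈ WordPoint.saturation w d M) (hc : ¬ color w p ≤ d) : p ∈ M := by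
  cases p with
  | z c => exact hp
  | x0 => exact hp
  | x i => exact (hp.2 i le_rfl).resolve_left hc
  | a i => exact hp
  | b i => exact hp.2.resolve_left hc

end WordPoint

/-- The lattice of closed sets of points of a word. -/
structure WordLattice {D : Type u} [PartialOrder D] [OrderTop D] {n : ℕ} (w : Fin n → D) :
    Type u where
  /-- The points of a closed set. -/
  carrier : Set (WordPoint.{u} n)
  closed' : WordPoint.Closed w carrier

/-! ### The lattice of closed sets and the points collapsed by its congruences -/

namespace WordLattice

open WordPoint

variable {D : Type u} {n : ℕ}

variable [PartialOrder D] [OrderTop D] {w : Fin n → D}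

instance : SetLike (WordLattice w) (WordPoint.{u} n) where
  coe := carrier
  coe_injective := by rintro ⟨A, _⟩ ⟨B, _⟩ h; cases h; rfl

instance : PartialOrder (WordLattice w) := .ofSetLike (WordLattice w) (WordPoint.{u} n)

theorem closed (A : WordLattice w) : Closed w (A : Set (WordPoint.{u} n)) := A.closed'

instance : Lattice (WordLattice w) where
  inf A B := ⟨A ∩ B, A.closed.inter B.closed⟩
  inf_le_left _ _ _ h := h.1
  inf_le_right _ _ _ h := h.2
  le_inf _ _ _ h h' _ hp := ⟨h hp, h' hp⟩
  sup A B := ⟨⋂₀ {M | Closed w M ∧ (A : Set (WordPoint.{u} n)) ⊆ M ∧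
    (B : Set (WordPoint.{u} n)) ⊆ M}, Closed.sInter fun _ h => h.1⟩
  le_sup_left _ _ _ hp _ hM := hM.2.1 hp
  le_sup_right _ _ _ hp _ hM := hM.2.2 hp
  sup_le _ _ C h h' _ hp := hp C ⟨C.closed, h, h'⟩

instance : Finite (WordLattice w) :=
  Finite.of_injective ((↑) : WordLattice w → Set (WordPoint.{u} n)) SetLike.coe_injective

instance : Nonempty (WordLattice w) := ⟨⟨_, closed_univ⟩⟩

theorem mem_mk {A : Set (WordPoint.{u} n)} {hA : Closed w A} {p : WordPoint.{u} n} :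
    p ∈ (⟨A, hA⟩ : WordLattice w) ↔ p ∈ A := Iff.rfl

/-- The closed set of the points that are at most `p`. -/
def principal (w : Fin n → D) (p : WordPoint.{u} n) : WordLattice w := ⟨down p, closed_down p⟩

/-- The closed set of the points that are less than `p`. -/
def lower (w : Fin n → D) (p : WordPoint.{u} n) : WordLattice w := ⟨down p \ {p}, closed_lower p⟩

theorem lower_le_principal (p : WordPoint.{u} n) : lower w p ≤ principal w p := fun _ h => h.1

theorem principal_le_iff {p : WordPoint.{u} n} {A : WordLattice w} :
    principal w p ≤ A ↔ p ∈ A :=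
  ⟨fun h => h (mem_down p), fun h => A.closed.down_subset h⟩

theorem mem_principal (p : WordPoint.{u} n) : p ∈ principal w p := mem_down p

theorem inf_principal_le_lower {p : WordPoint.{u} n} {A : WordLattice w} (hp : p ∉ A) :
    A ⊓ principal w p ≤ lower w p :=
  fun _ hq => ⟨hq.2, fun h => hp (Set.mem_singleton_iff.1 h ▸ hq.1)⟩

/-- The congruence of the lattice of a word that collapses all the points with color at most
`d`. -/
def congruence (w : Fin n → D) (d : D) : LatticeCon (WordLattice w) where
  r A B := ∀ p, ¬ color w p ≤ d → (p ∈ A ↔ p ∈ B)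
  iseqv :=
    { refl := fun _ _ _ => Iff.rfl
      symm := fun h p hp => (h p hp).symm
      trans := fun h h' p hp => (h p hp).trans (h' p hp) }
  inf h h' p hp := and_congr (h p hp) (h' p hp)
  sup {A B A' B'} h h' := by
    have key : ∀ A B A' B' : WordLattice w, (∀ p, ¬ color w p ≤ d → (p ∈ A ↔ p ∈ B)) →
        (∀ p, ¬ color w p ≤ d → (p ∈ A' ↔ p ∈ B')) →
        ∀ p, ¬ color w p ≤ d → p ∈ A ⊔ A' → p ∈ B ⊔ B' := by
      intro A B A' B' h h' p hp hpA
      have hd : d ≠ ⊤ := fun hd => hp (hd ▸ le_top)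
      -- The saturation of `B ⊔ B'` is closed and contains `A` and `A'`, hence `A ⊔ A'`, yet gains
      -- only points of color at most `d`.
      refine mem_of_mem_saturation (d := d) (M := (B ⊔ B' : WordLattice w)) ?_ hp
      refine hpA _ ⟨(B ⊔ B').closed.saturation hd, ?_, ?_⟩
      · exact A.closed.subset_saturation hd fun q hq hc =>
          (le_sup_left : B ≤ B ⊔ B') ((h q hc).1 hq)
      · exact A'.closed.subset_saturation hd fun q hq hc =>
          (le_sup_right : B' ≤ B ⊔ B') ((h' q hc).1 hq)
    exact fun p hp => ⟨key _ _ _ _ h h' p hp, key _ _ _ _ (fun p hp => (h p hp).symm)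
      (fun p hp => (h' p hp).symm) p hp⟩

/-- A congruence collapses the point `p` if it relates `p` to the join of the smaller points. -/
def Collapses (θ : LatticeCon (WordLattice w)) (p : WordPoint.{u} n) : Prop :=
  θ.r (lower w p) (principal w p)

/-- Meeting with `principal w p` and then joining with `lower w p` sends `A` to `lower w p` and `B`
to `principal w p`. -/
theorem collapses_of_r {θ : LatticeCon (WordLattice w)} {A B : WordLattice w} (h : θ.r A B)
    {p : WordPoint.{u} n} (hA : p ∉ A) (hB : p ∈ B) : Collapses θ p := by
  have h1 := θ.sup (θ.inf h (θ.refl (principal w p))) (θ.refl (lower w p))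
  rwa [sup_eq_right.2 (inf_principal_le_lower hA), inf_eq_right.2 (principal_le_iff.2 hB),
    sup_eq_left.2 (lower_le_principal p)] at h1

theorem collapses_of_r' {θ : LatticeCon (WordLattice w)} {A B : WordLattice w} (h : θ.r A B)
    {p : WordPoint.{u} n} (hp : ¬ (p ∈ A ↔ p ∈ B)) : Collapses θ p := by
  by_cases hA : p ∈ A
  · exact collapses_of_r (θ.symm h) (fun hB => hp (iff_of_true hA hB)) hA
  · exact collapses_of_r h hA (by_contra fun hB => hp (iff_of_false hA hB))

/-- Climb from `B` to `A` by adjoining a missing point `p` of least rank: all points below `p` are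
then in `B`, so the collapse of `p` relates `B` to `principal w p ⊔ B`. -/
theorem r_of_le {θ : LatticeCon (WordLattice w)} {A B : WordLattice w} (hBA : B ≤ A)
    (h : ∀ p ∈ A, p ∉ B → Collapses θ p) : θ.r B A := by
  induction B using WellFoundedGT.induction with
  | ind B ih =>
    by_cases hAB : A ≤ B
    · rw [le_antisymm hBA hAB]
    obtain ⟨p₀, hp₀⟩ : ∃ p, p ∈ A ∧ p ∉ B := by
      by_contra! hc
      exact hAB hc
    obtain ⟨p, ⟨hpA, hpB⟩, hmin⟩ := Set.exists_min_image {p | p ∈ A ∧ p ∉ B} rank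
      (Set.toFinite _) ⟨p₀, hp₀⟩
    have hlow : lower w p ≤ B := by
      intro q hq
      by_contra hqB
      exact (rank_lt hq.1 hq.2).not_ge (hmin q ⟨principal_le_iff.2 hpA hq.1, hqB⟩)
    have h1 : θ.r B (principal w p ⊔ B) := by
      have := θ.sup (h p hpA hpB) (θ.refl B)
      rwa [sup_eq_right.2 hlow] at this
    refine θ.trans h1 (ih _ ?_ (sup_le (principal_le_iff.2 hpA) hBA) ?_)
    · exact right_lt_sup.2 fun hle => hpB (principal_le_iff.1 hle)
    · exact fun q hq hqB => h q hq fun hB => hqB (le_sup_right (a := principal w p) hB)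

/-- A congruence relates two closed sets if and only if it collapses all the points in which they
differ. -/
theorem r_iff {θ : LatticeCon (WordLattice w)} {A B : WordLattice w} :
    θ.r A B ↔ ∀ p, ¬ (p ∈ A ↔ p ∈ B) → Collapses θ p := by
  refine ⟨fun h p hp => collapses_of_r' h hp, fun h => ?_⟩
  have h1 : θ.r (A ⊓ B) A := r_of_le inf_le_left fun p hA hB =>
    h p fun hAB => hB ⟨hA, hAB.1 hA⟩
  have h2 : θ.r (A ⊓ B) B := r_of_le inf_le_right fun p hA hB =>
    h p fun hAB => hB ⟨hAB.2 hA, hA⟩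
  exact θ.trans (θ.symm h1) h2

theorem collapses_congruence {d : D} {p : WordPoint.{u} n} :
    Collapses (congruence w d) p ↔ color w p ≤ d := by
  constructor
  · intro h
    by_contra hp
    exact ((h p hp).2 (mem_principal p)).2 rfl
  · intro h q hq
    refine ⟨fun h' => h'.1, fun h' => ⟨h', ?_⟩⟩
    rintro rfl
    exact hq h

theorem eq_congruence {θ : LatticeCon (WordLattice w)} {d : D}
    (h : ∀ p, Collapses θ p ↔ color w p ≤ d) : θ = congruence w d := by
  have : ∀ A B, θ.r A B ↔ (congruence w d).r A B := fun A B => by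
    rw [r_iff, r_iff]
    simp only [h, collapses_congruence]
  exact le_antisymm (fun A B => (this A B).1) fun A B => (this A B).2

/-- If every closed set containing `p` and the members of `C` contains `q`, and `q` is not forced
by the points less than `p` and `C`, then a congruence collapsing `p` also collapses `q`. -/
theorem Collapses.of_closed {θ : LatticeCon (WordLattice w)} {p q : WordPoint.{u} n}
    (h : Collapses θ p) (C K : WordLattice w) (hK : lower w p ≤ K) (hC : C ≤ K) (hq : q ∉ K)
    (hpC : ∀ M : WordLattice w, p ∈ M → C ≤ M → q ∈ M) : Collapses θ q :=
  collapses_of_r (θ.sup h (θ.refl C)) (fun hq' => hq (sup_le hK hC hq'))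
    (hpC _ (principal_le_iff.1 le_sup_left) le_sup_right)

variable {θ : LatticeCon (WordLattice w)}

theorem Collapses.b_of_x {i : Fin n} (h : Collapses θ (x i)) : Collapses θ (b i) := by
  refine h.of_closed (principal w (a i)) ⟨_, closed_x0_a i⟩ ?_ ?_ ?_ ?_
  · rintro _ ⟨rfl | ⟨j, hj, rfl⟩, h2⟩
    · simp [mem_mk]
    · have : j ≠ i := fun h => h2 (by simp [h])
      simp [mem_mk, lt_of_le_of_ne hj this]
  · rw [principal_le_iff]; simp [mem_mk]
  · simp [mem_mk]
  · exact fun M h1 h2 => M.closed.b_mem_of_x h1 (principal_le_iff.1 h2)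

theorem lower_b_le {i : Fin n} {A : WordLattice w} (h : a i ∈ A) : lower w (b i) ≤ A := by
  rintro _ ⟨rfl | rfl, h2⟩
  · exact h
  · exact (h2 rfl).elim

theorem Collapses.x_of_b {i : Fin n} (h : Collapses θ (b i)) : Collapses θ (x i) := by
  refine h.of_closed (principal w x0) ⟨_, closed_x0_a i⟩ (lower_b_le ?_) ?_ ?_ ?_
  · simp [mem_mk]
  · rw [principal_le_iff]; simp [mem_mk]
  · simp [mem_mk]
  · exact fun M h1 h2 => M.closed.x_mem_of_b (principal_le_iff.1 h2) h1

theorem Collapses.b_of_b {i j : Fin n} (h : Collapses θ (b i)) (hij : w j ≤ w i) :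
    Collapses θ (b j) := by
  refine h.of_closed (principal w (a j)) ⟨_, closed_pair hij⟩ (lower_b_le ?_) ?_ ?_ ?_
  · simp [mem_mk]
  · rw [principal_le_iff]; simp [mem_mk]
  · simp [mem_mk]
  · exact fun M h1 h2 => M.closed.b_mem_of_b h1 (principal_le_iff.1 h2) hij

theorem Collapses.z_of_b {i : Fin n} (h : Collapses θ (b i)) (hi : w i = ⊤) (c : Bool) :
    Collapses θ (z c) := by
  refine h.of_closed (principal w x0) ⟨_, closed_x0_a i⟩ (lower_b_le ?_) ?_ ?_ ?_
  · simp [mem_mk]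
  · rw [principal_le_iff]; simp [mem_mk]
  · simp [mem_mk]
  · exact fun M h1 h2 => M.closed.mem_of_top _ (principal_le_iff.1 h2) h1 hi

theorem Collapses.of_atom {p q : WordPoint.{u} n} (h : Collapses θ p) (hp : down p = {p})
    {c : Bool} (hpc : p ≠ z c) (hq : q ≠ z c) : Collapses θ q := by
  refine h.of_closed (principal w (z c)) (principal w (z c)) ?_ le_rfl hq ?_
  · intro r hr
    exact (hr.2 (hp ▸ hr.1)).elim
  · exact fun M h1 h2 => M.closed.mem_of_z q (principal_le_iff.1 h2) h1 hpc

/-- `of_atom` needs a `z c` different from both points. Passing through `x0` lets each of the two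
steps choose its own `c`, which is why there are two such atoms. -/
theorem Collapses.all {p : WordPoint.{u} n} (h : Collapses θ p) (hp : down p = {p})
    (q : WordPoint.{u} n) : Collapses θ q := by
  have h0 : Collapses θ x0 := by
    by_cases hpc : p = z true
    · exact h.of_atom hp (c := false) (by simp [hpc]) (by simp)
    · exact h.of_atom hp hpc (by simp)
  by_cases hq : q = z true
  · exact h0.of_atom rfl (c := false) (by simp) (by simp [hq])
  · exact h0.of_atom rfl (c := true) (by simp) hq

end WordLattice

/-! ### Color joins of intervals and the isomorphism with the congruence lattice -/

namespace WordLattice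

open WordPoint

variable {D : Type u} {n : ℕ}

theorem exists_x_mem_iff [PartialOrder D] [OrderTop D] {w : Fin n → D} (A : WordLattice w) :
    ∃ m : ℕ, ∀ k, x k ∈ A ↔ k.1 < m := by
  classical
  have hex : ∃ m : ℕ, ∀ k, x k ∈ A → k.1 < m := ⟨n, fun k _ => k.2⟩
  refine ⟨Nat.find hex, fun k => ⟨Nat.find_spec hex k, fun hk => ?_⟩⟩
  by_contra hkA
  exact Nat.find_min hex hk fun j hj => by
    by_contra hjk
    exact hkA (A.closed.x_mem hj (not_lt.1 hjk))

section

variable [PartialOrder D] [OrderTop D] {w : Fin n → D}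

/-- The join of the colors of the points between two closed sets is the join of an infix of the
word. -/
theorem mem_wordJoins_of_isLUB (htop : ∃ k, w k = ⊤) {A B : WordLattice w} (hAB : A ≤ B) {d : D}
    (hd : IsLUB {e | ∃ p, p ∈ B ∧ p ∉ A ∧ color w p = e} d) : d ∈ wordJoins w := by
  by_cases hex : ∃ p, p ∈ B ∧ p ∉ A ∧ color w p = ⊤
  · obtain ⟨k, hk⟩ := htop
    rw [top_unique (hd.1 hex), ← hk]
    exact mem_wordJoins w k
  have hatom : ∀ p, p ∈ B → color w p = ⊤ → p ∈ A := fun p hp hc =>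
    by_contra fun hpA => hex ⟨p, hp, hpA, hc⟩
  by_cases hx0 : x0 ∈ A
  · obtain ⟨i, hi⟩ := exists_x_mem_iff A
    obtain ⟨j, hj⟩ := exists_x_mem_iff B
    refine ⟨i, j, ?_⟩
    convert hd using 1
    ext e
    constructor
    · rintro ⟨k, h1, h2, rfl⟩
      exact ⟨x k, (hj k).2 h2, fun h => ((hi k).1 h).not_ge h1, rfl⟩
    · rintro ⟨p, hB, hA, rfl⟩
      have key : ∀ k, x k ∈ B → x k ∉ A → ∃ k' : Fin n, i ≤ k'.1 ∧ k'.1 < j ∧ w k' = w k :=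
        fun k hB hA => ⟨k, not_lt.1 fun h => hA ((hi k).2 h), (hj k).1 hB, rfl⟩
      cases p with
      | x k => exact key k hB hA
      | b k =>
        -- With `x0` in both sets, `b k` lies between them only if `x k`, of the same color, does.
        refine key k (B.closed.x_mem_of_b (hAB hx0) hB) fun hx => hA ?_
        exact A.closed.b_mem_of_x hx (hatom _ (B.closed.a_mem hB) rfl)
      | _ => exact (hA (hatom _ hB rfl)).elim
  · have hS : {e | ∃ p, p ∈ B ∧ p ∉ A ∧ color w p = e} = w '' {k | b k ∈ B ∧ b k ∉ A} := by
      ext e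
      constructor
      · rintro ⟨p, hB, hA, rfl⟩
        cases p with
        | x k => exact (hx0 (hatom _ (B.closed.x0_mem hB) rfl)).elim
        | b k => exact ⟨k, ⟨hB, hA⟩, rfl⟩
        | _ => exact (hA (hatom _ hB rfl)).elim
      · rintro ⟨k, ⟨hB, hA⟩, rfl⟩
        exact ⟨b k, hB, hA, rfl⟩
    rw [hS] at hd
    rcases Set.eq_empty_or_nonempty {k | b k ∈ B ∧ b k ∉ A} with he | hne
    · rw [he, Set.image_empty] at hd
      exact mem_wordJoins_of_isLUB_empty hd
    -- Two incomparable letters here would make `A` everything, their `a`-points being in `A`; so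
    -- the join is the largest letter.
    obtain ⟨k, hk⟩ := (Set.toFinite {k | b k ∈ B ∧ b k ∉ A}).exists_maximalFor w _ hne
    have hmax : IsGreatest (w '' {k | b k ∈ B ∧ b k ∉ A}) (w k) := by
      refine ⟨⟨k, hk.1, rfl⟩, ?_⟩
      rintro _ ⟨j, hj, rfl⟩
      by_contra hjk
      refine hk.1.2 (A.closed.mem_of_not_le _ (hatom (a j) (B.closed.a_mem hj.1) rfl)
        (hatom (a k) (B.closed.a_mem hk.1.1) rfl) hjk fun hkj => hjk (hk.2 hj hkj))
    rw [hd.unique hmax.isLUB]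
    exact mem_wordJoins w k

/-- The closed set of the points `x0` and `x k`, `k < m`, of the chain. -/
def chain (w : Fin n → D) (m : ℕ) : WordLattice w :=
  ⟨{p | p = x0 ∨ ∃ k : Fin n, k.1 < m ∧ p = x k}, closed_chain m⟩

theorem isLUB_chain_iff (i j : ℕ) (hij : i ≤ j) {d : D} :
    IsLUB {e | ∃ p, ¬ (p ∈ chain w i ↔ p ∈ chain w j) ∧ color w p = e} d ↔
      IsLUB {e | ∃ k : Fin n, i ≤ k.1 ∧ k.1 < j ∧ w k = e} d := by
  have hx : ∀ m k, x k ∈ chain w m ↔ k.1 < m := by simp [chain, mem_mk]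
  suffices {e | ∃ p, ¬ (p ∈ chain w i ↔ p ∈ chain w j) ∧ color w p = e} =
      {e | ∃ k : Fin n, i ≤ k.1 ∧ k.1 < j ∧ w k = e} by rw [this]
  ext e
  constructor
  · rintro ⟨p, hp, rfl⟩
    cases p with
    | x k => exact ⟨k, by rw [hx, hx] at hp; omega, by rw [hx, hx] at hp; omega, rfl⟩
    | _ => simp [chain, mem_mk] at hp
  · rintro ⟨k, h1, h2, rfl⟩
    exact ⟨x k, by rw [hx, hx]; omega, rfl⟩

end

section

variable [DistribLattice D] [BoundedOrder D] {w : Fin n → D}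

/-- An element is the join of the join-irreducibles below it, and each of these is the color of some
`x k`. -/
theorem congruence_le_iff [Finite D] (hs : ∀ c, SupIrred c → ∃ k, w k = c) {d e : D} :
    congruence w d ≤ congruence w e ↔ d ≤ e := by
  constructor
  · intro h
    obtain ⟨s, rfl, hirr⟩ := exists_supIrred_decomposition d
    refine Finset.sup_le fun c hc => ?_
    obtain ⟨k, rfl⟩ := hs c (hirr hc)
    have h1 : Collapses (congruence w (s.sup id)) (x k) :=
      collapses_congruence.2 (Finset.le_sup (f := id) hc)
    exact collapses_congruence.1 (h _ _ h1 : Collapses (congruence w e) (x k))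
  · exact fun h A B hAB p hp => hAB p fun hc => hp (hc.trans h)

theorem exists_eq_congruence (hD : SupIrred (⊤ : D)) (hw : ∀ k, SupIrred (w k))
    (hs : ∀ c, SupIrred c → ∃ k, w k = c) (θ : LatticeCon (WordLattice w)) :
    ∃ d, congruence w d = θ := by
  classical
  let s : Finset (Fin n) := Finset.univ.filter fun k => Collapses θ (x k)
  have hmem : ∀ k, k ∈ s ↔ Collapses θ (x k) := by simp [s]
  have hle : ∀ k, Collapses θ (x k) → w k ≤ s.sup w := fun k hk =>
    Finset.le_sup (f := w) ((hmem k).2 hk)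
  have hb : ∀ k, w k ≤ s.sup w → Collapses θ (b k) := by
    intro k hk
    -- By distributivity the letter is join-prime, so it lies below a single collapsed letter.
    obtain ⟨j, hj, hkj⟩ := (hw k).supPrime.le_finset_sup.1 hk
    exact ((hmem j).1 hj).b_of_x.b_of_b hkj
  obtain ⟨t, ht⟩ := hs ⊤ hD
  have hatom : ∀ p : WordPoint.{u} n, down p = {p} → (Collapses θ p ↔ ⊤ ≤ s.sup w) := by
    refine fun p hp => ⟨fun h => ?_, fun h => ?_⟩
    · rw [← ht]
      exact hle t (h.all hp _)
    · exact ((hb t (ht ▸ h)).z_of_b ht true).all rfl _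
  refine ⟨s.sup w, (eq_congruence fun p => ?_).symm⟩
  cases p with
  | x k => exact ⟨hle k, fun h => (hb k h).x_of_b⟩
  | b k => exact ⟨fun h => hle k h.x_of_b, hb k⟩
  | z c => exact hatom _ rfl
  | x0 => exact hatom _ rfl
  | a k => exact hatom _ rfl

/-- The upper bounds of the colors of the differing points are the `e` with `con(A, B) ≤ congruence
w e`, and every congruence has this form. -/
theorem principal_eq_congruence_iff [Finite D] (hD : SupIrred (⊤ : D)) (hw : ∀ k, SupIrred (w k))
    (hs : ∀ c, SupIrred c → ∃ k, w k = c) {A B : WordLattice w} {d : D} :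
    LatticeCon.principal A B = congruence w d ↔
      IsLUB {e | ∃ p, ¬ (p ∈ A ↔ p ∈ B) ∧ color w p = e} d := by
  have hub : ∀ e, e ∈ upperBounds {e | ∃ p, ¬ (p ∈ A ↔ p ∈ B) ∧ color w p = e} ↔
      LatticeCon.principal A B ≤ congruence w e := by
    intro e
    rw [LatticeCon.principal_le_iff, r_iff]
    simp only [collapses_congruence]
    exact ⟨fun h p hp => h ⟨p, hp, rfl⟩, by rintro h _ ⟨p, hp, rfl⟩; exact h p hp⟩
  rw [isLUB_iff_le_iff]
  simp only [hub]
  constructor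
  · intro h e
    rw [h, congruence_le_iff hs]
  · intro h
    obtain ⟨d', hd'⟩ := exists_eq_congruence hD hw hs (LatticeCon.principal A B)
    refine le_antisymm ((h d).1 le_rfl) ?_
    rw [← hd', congruence_le_iff hs]
    exact (h d').2 hd'.ge

end

end WordLattice

/-! ### From a chain to a lattice -/

open WordLattice in
theorem IsChainRepresentable.isPrincipalCongruenceRepresentable {D : Type u} [DistribLattice D]
    [BoundedOrder D] [Finite D] (hD : SupIrred (⊤ : D)) {Q : Set D}
    (h : IsChainRepresentable Q) : IsPrincipalCongruenceRepresentable Q := by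
  obtain ⟨n, w, hw, hs, rfl⟩ := (isChainRepresentable_iff Q).1 h
  let φ : D ≃o LatticeCon (WordLattice w) := RelIso.ofSurjective
    (OrderEmbedding.ofMapLEIff (congruence w) fun _ _ => congruence_le_iff hs)
    (exists_eq_congruence hD hw hs)
  have hφ : ∀ (A B : WordLattice w) (d : D), φ.symm (LatticeCon.principal A B) = d ↔
      IsLUB {e | ∃ p, ¬ (p ∈ A ↔ p ∈ B) ∧ WordPoint.color w p = e} d := by
    intro A B d
    rw [← principal_eq_congruence_iff hD hw hs, OrderIso.symm_apply_eq]
    rfl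
  refine ⟨WordLattice w, inferInstance, inferInstance, inferInstance, φ.symm, ?_⟩
  ext d
  constructor
  · rintro ⟨_, ⟨A, B, rfl⟩, hd⟩
    rw [← LatticeCon.principal_inf_sup, hφ] at hd
    have hle : A ⊓ B ≤ A ⊔ B := inf_le_sup
    refine mem_wordJoins_of_isLUB (hs ⊤ hD) hle ?_
    have hiff : ∀ p, ¬ (p ∈ A ⊓ B ↔ p ∈ A ⊔ B) ↔ p ∈ A ⊔ B ∧ p ∉ A ⊓ B := fun p => by
      have := @hle p
      tauto
    simpa only [hiff, and_assoc] using hd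
  · rintro ⟨i, j, hd⟩
    -- `max i j` orders the ends; for `j < i` both infixes are empty.
    refine ⟨_, ⟨chain w i, chain w (max i j), rfl⟩, (hφ _ _ _).2 ?_⟩
    rw [isLUB_chain_iff _ _ (le_max_left _ _)]
    have hk : ∀ k : Fin n, (i ≤ k.1 ∧ k.1 < max i j) ↔ (i ≤ k.1 ∧ k.1 < j) := by omega
    simpa only [← and_assoc, hk] using hd

theorem theorem3 {D : Type u} [DistribLattice D] [BoundedOrder D] [Finite D]
    (hD : SupIrred (⊤ : D)) (Q : Set D) :
    IsPrincipalCongruenceRepresentable Q ↔ IsChainRepresentable Q :=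
  ⟨fun h => h.isChainRepresentable hD, fun h => h.isPrincipalCongruenceRepresentable hD⟩
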